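/- All Hilbert spaces are finite-dimensional; a state is a positive semidefinite operator of trace one, and a measurement is a finite family of positive semidefinite operators summing to the identity. Fix states $\omega_1,\dots,\omega_{i_A}$ on $A'$, a measurement $\{M_a^{A'A}\}$ on $A'A$ and a state $\rho^{AB}$ on $AB$. Alice's generalised measurement set is $M^A_{a|\omega_x}=\mathrm{tr}_{A'}[M_a^{A'A}(\omega_x\otimes 1^A)]$, and the resulting teleportation assemblage is $\tau^B_{a|\omega_x}=\mathrm{tr}_A[(M^A_{a|\omega_x}\otimes 1^B)\rho^{AB}]$. A generalised measurement set of Bob is given by any finite family of states $\zeta_y$ on any system $B'$ and any measurement $\{M_b^{BB'}\}$ through $M^B_{b|\zeta_y}=\mathrm{tr}_{B'}[M_b^{BB'}(1^B\otimes\zeta_y)]$; it yields the behaviour $p(a,b|\omega_x,\zeta_y)=\mathrm{tr}[(M^A_{a|\omega_x}\otimes M^B_{b|\zeta_y})\rho^{AB}]$. The robustness of teleportation $R_{\mathrm T}(\{\tau_{a|\omega_x}\})$ is the infimum of the $r\ge 0$ for which there are a teleportation assemblage $\{\sigma_{a|\omega_x}\}$ on $B$ with the same inputs $\omega_x$ (generated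 by any measurement on $A'\tilde A$ and any state on $\tilde AB$, for any system $\tilde A$), a finite probability distribution $q$, measurements $\{H_{a|\lambda}\}_a$ on $A'$ and states $\sigma_\lambda$ on $B$ such that $$\frac{\tau_{a|\omega_x}+r\,\sigma_{a|\omega_x}}{1+r}=\sum_\lambda q(\lambda)\,\mathrm{tr}[H_{a|\lambda}\omega_x]\,\sigma_\lambda\qquad\text{for all }a,x.$$ The robustness of Buscemi nonlocality $R_{\mathrm{BN}}(\{p(a,b|\omega_x,\zeta_y)\})$ is the infimum of the $r\ge 0$ for which there are a behaviour $g(a,b|\omega_x,\zeta_y)$ with the same inputs (generated by any measurements on $A'\tilde A$ and $\tilde BB'$ and any state on $\tilde A\tilde B$, for any systems $\tilde A,\tilde B$), a finite probability distribution $q$ and measurements $\{H_{a|\lambda}\}_a$ on $A'$ and $\{K_{b|\lambda}\}_b$ on $B'$ such that $$\frac{p(a,b|\omega_x,\zeta_y)+r\,g(a,b|\omega_x,\zeta_y)}{1+r}=\sum_\lambda q(\lambda)\,\mathrm{tr}[H_{a|\lambda}\omega_x]\,\mathrm{tr}[K_{b|\lambda}\zeta_y]\qquad\text{for all }a,b,x,y.$$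 Then both infima are over nonempty sets, and $$\max_{\{M^B_{b|\zeta_y}\}}R_{\mathrm{BN}}\big(\{p(a,b|\omega_x,\zeta_y)\}\big)=R_{\mathrm T}\big(\{\tau_{a|\omega_x}\}\big),$$ where the maximum is over all generalised measurement sets of Bob (all finite-dimensional systems $B'$, finite numbers of inputs and outcomes, input states and measurements) and is attained. Moreover, let $d=\dim B$, $B'\cong B\cong\mathbb C^d$, let $U_b$ run over the $d^2$ generalised Pauli operators $X^jZ^k$ with $X^jZ^k|n\rangle=e^{2\pi i kn/d}|n+j \bmod d\rangle$, and let $\phi_+=d^{-1}\sum_{i,j}|i\rangle\langle j|\otimes|i\rangle\langle j|$. Then $M_b=(1\otimes U_b)\,\phi_+\,(1\otimes U_b)^\dagger$ is a measurement on $BB'$ and, for every finite family of states $\zeta_y$ on $B'$ that is tomographically complete (spans all operators on $B'$), Bob's generalised measurement set given by $\{M_b\}$ and $\{\zeta_y\}$ attains the maximum. -/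

import Mathlib

open scoped Kronecker ComplexOrder Matrix

noncomputable section

namespace Buscemi

/-! Operators on `ℂ^m` are matrices indexed by a finite type `m`, and operators on a tensor product
are matrices indexed by `m × n`. -/

/-- Partial trace over the first tensor factor. -/
def trLeft {m n : Type*} [Fintype m] (M : Matrix (m × n) (m × n) ℂ) : Matrix n n ℂ :=
  Matrix.of fun i j => ∑ k, M (k, i) (k, j)

/-- Partial trace over the second tensor factor. -/
def trRight {m n : Type*} [Fintype n] (M : Matrix (m × n) (m × n) ℂ) : Matrix m m ℂ :=
  Matrix.of fun i j => ∑ k, M (i, k) (j, k)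

/-- Density operators. -/
def IsState {m : Type*} [Fintype m] (ρ : Matrix m m ℂ) : Prop :=
  ρ.PosSemidef ∧ ρ.trace = 1

/-- Measurements (POVMs) with outcomes in `O`. -/
def IsPOVM {m O : Type*} [DecidableEq m] [Fintype O] (M : O → Matrix m m ℂ) : Prop :=
  (∀ a, (M a).PosSemidef) ∧ ∑ a, M a = 1

/-- Alice's generalised measurement set `M_{a|ω_x}^A = tr_{A'} [M_a^{A'A} (ω_x ⊗ 1)]`;
`V` indexes the input system `A'`. -/
def aliceMeas {V A O X : Type*} [Fintype V] [Fintype A] [DecidableEq A]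
    (M : O → Matrix (V × A) (V × A) ℂ) (ω : X → Matrix V V ℂ) (a : O) (x : X) : Matrix A A ℂ :=
  trLeft (M a * (ω x ⊗ₖ (1 : Matrix A A ℂ)))

/-- Bob's generalised measurement set `M_{b|ζ_y}^B = tr_{B'} [M_b^{BB'} (1 ⊗ ζ_y)]`;
`W` indexes the input system `B'`. -/
def bobMeas {B W O Y : Type*} [Fintype B] [DecidableEq B] [Fintype W]
    (M : O → Matrix (B × W) (B × W) ℂ) (ζ : Y → Matrix W W ℂ) (b : O) (y : Y) : Matrix B B ℂ :=
  trRight (M b * ((1 : Matrix B B ℂ) ⊗ₖ ζ y))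

/-- The teleportation assemblage `τ_{a|ω_x}^B = tr_A [(M_{a|ω_x}^A ⊗ 1) ρ^{AB}]`. -/
def assemblage {V A B O X : Type*} [Fintype V] [Fintype A] [DecidableEq A] [Fintype B]
    [DecidableEq B] (M : O → Matrix (V × A) (V × A) ℂ) (ω : X → Matrix V V ℂ)
    (ρ : Matrix (A × B) (A × B) ℂ) (a : O) (x : X) : Matrix B B ℂ :=
  trLeft ((aliceMeas M ω a x ⊗ₖ (1 : Matrix B B ℂ)) * ρ)

/-- The behaviour `p(a,b|ω_x,ζ_y) = tr [(M_{a|ω_x}^A ⊗ M_{b|ζ_y}^B) ρ^{AB}]`. -/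
def behaviour {V A B W O P X Y : Type*} [Fintype V] [Fintype A] [DecidableEq A] [Fintype B]
    [DecidableEq B] [Fintype W] (M : O → Matrix (V × A) (V × A) ℂ) (ω : X → Matrix V V ℂ)
    (N : P → Matrix (B × W) (B × W) ℂ) (ζ : Y → Matrix W W ℂ)
    (ρ : Matrix (A × B) (A × B) ℂ) (a : O) (b : P) (x : X) (y : Y) : ℂ :=
  ((aliceMeas M ω a x ⊗ₖ bobMeas N ζ b y) * ρ).trace

/-- `σ` is a teleportation assemblage with input states `ω`: it is generated by some bipartite
measurement and some shared state, Alice's share being of arbitrary finite dimension. -/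
def IsAssemblage {V B O X : Type*} [Fintype V] [DecidableEq V] [Fintype B] [DecidableEq B]
    [Fintype O] (ω : X → Matrix V V ℂ) (σ : O → X → Matrix B B ℂ) : Prop :=
  ∃ (d : ℕ) (N : O → Matrix (V × Fin d) (V × Fin d) ℂ) (η : Matrix (Fin d × B) (Fin d × B) ℂ),
    IsPOVM N ∧ IsState η ∧ σ = assemblage N ω η

/-- `σ` has a local model `σ_{a|ω_x} = ∑_λ q(λ) tr[H_{a|λ} ω_x] σ_λ`. -/
def IsClassicalAssemblage {V B O X : Type*} [Fintype V] [DecidableEq V] [Fintype B]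
    [Fintype O] (ω : X → Matrix V V ℂ) (σ : O → X → Matrix B B ℂ) : Prop :=
  ∃ (n : ℕ) (q : Fin n → ℝ) (H : Fin n → O → Matrix V V ℂ) (s : Fin n → Matrix B B ℂ),
    q ∈ stdSimplex ℝ (Fin n) ∧ (∀ l, IsPOVM (H l)) ∧ (∀ l, IsState (s l)) ∧
    ∀ a x, σ a x = ∑ l, ((q l : ℂ) * (H l a * ω x).trace) • s l

/-- `p` is a behaviour with input states `ω` and `ζ`: it is generated by some bipartite
measurements of Alice and Bob on some shared state of arbitrary finite local dimensions. -/
def IsBehaviour {V W O P X Y : Type*} [Fintype V] [DecidableEq V] [Fintype W] [DecidableEq W]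
    [Fintype O] [Fintype P] (ω : X → Matrix V V ℂ) (ζ : Y → Matrix W W ℂ)
    (p : O → P → X → Y → ℂ) : Prop :=
  ∃ (d e : ℕ) (M : O → Matrix (V × Fin d) (V × Fin d) ℂ)
    (N : P → Matrix (Fin e × W) (Fin e × W) ℂ) (η : Matrix (Fin d × Fin e) (Fin d × Fin e) ℂ),
    IsPOVM M ∧ IsPOVM N ∧ IsState η ∧ p = behaviour M ω N ζ η

/-- `p` has a local model `p(a,b|ω_x,ζ_y) = ∑_λ q(λ) tr[H_{a|λ} ω_x] tr[K_{b|λ} ζ_y]`. -/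
def IsLocalBehaviour {V W O P X Y : Type*} [Fintype V] [DecidableEq V] [Fintype W]
    [DecidableEq W] [Fintype O] [Fintype P] (ω : X → Matrix V V ℂ) (ζ : Y → Matrix W W ℂ)
    (p : O → P → X → Y → ℂ) : Prop :=
  ∃ (n : ℕ) (q : Fin n → ℝ) (H : Fin n → O → Matrix V V ℂ) (K : Fin n → P → Matrix W W ℂ),
    q ∈ stdSimplex ℝ (Fin n) ∧ (∀ l, IsPOVM (H l)) ∧ (∀ l, IsPOVM (K l)) ∧
    ∀ a b x y, p a b x y = ∑ l, (q l : ℂ) * (H l a * ω x).trace * (K l b * ζ y).trace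

/-- The noise weights `r ≥ 0` such that some teleportation assemblage `σ` with the same inputs
makes `(τ + r σ) / (1 + r)` classical. -/
def teleportationWeights {V B O X : Type*} [Fintype V] [DecidableEq V] [Fintype B]
    [DecidableEq B] [Fintype O] (ω : X → Matrix V V ℂ) (τ : O → X → Matrix B B ℂ) : Set ℝ :=
  {r | 0 ≤ r ∧ ∃ σ L : O → X → Matrix B B ℂ, IsAssemblage ω σ ∧ IsClassicalAssemblage ω L ∧
    ∀ a x, τ a x + (r : ℂ) • σ a x = (1 + r : ℂ) • L a x}

/-- The generalised robustness of teleportation `R_T`. -/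
def robustnessT {V B O X : Type*} [Fintype V] [DecidableEq V] [Fintype B] [DecidableEq B]
    [Fintype O] (ω : X → Matrix V V ℂ) (τ : O → X → Matrix B B ℂ) : ℝ :=
  sInf (teleportationWeights ω τ)

/-- The noise weights `r ≥ 0` such that some behaviour `g` with the same inputs makes
`(p + r g) / (1 + r)` local. -/
def buscemiWeights {V W O P X Y : Type*} [Fintype V] [DecidableEq V] [Fintype W]
    [DecidableEq W] [Fintype O] [Fintype P] (ω : X → Matrix V V ℂ) (ζ : Y → Matrix W W ℂ)
    (p : O → P → X → Y → ℂ) : Set ℝ :=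
  {r | 0 ≤ r ∧ ∃ g L : O → P → X → Y → ℂ, IsBehaviour ω ζ g ∧ IsLocalBehaviour ω ζ L ∧
    ∀ a b x y, p a b x y + (r : ℂ) * g a b x y = (1 + r : ℂ) * L a b x y}

/-- The generalised robustness of Buscemi nonlocality `R_BN`. -/
def robustnessBN {V W O P X Y : Type*} [Fintype V] [DecidableEq V] [Fintype W]
    [DecidableEq W] [Fintype O] [Fintype P] (ω : X → Matrix V V ℂ) (ζ : Y → Matrix W W ℂ)
    (p : O → P → X → Y → ℂ) : ℝ :=
  sInf (buscemiWeights ω ζ p)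

/-- A family of operators is tomographically complete if it spans all operators. -/
def TomographicallyComplete {W Y : Type*} (ζ : Y → Matrix W W ℂ) : Prop :=
  Submodule.span ℂ (Set.range ζ) = ⊤

/-- Generalised Pauli operators: the pair `(j, k)` gives
`X^j Z^k |n⟩ = exp(2πi k n / d) |n + j mod d⟩`. -/
def genPauli (d : ℕ) (jk : Fin d × Fin d) : Matrix (Fin d) (Fin d) ℂ :=
  Matrix.of fun m n => if m = n + jk.1 then
    Complex.exp (2 * Real.pi * Complex.I * (jk.2 : ℕ) * (n : ℕ) / d) else 0

/-- The maximally entangled state `φ₊ = d⁻¹ ∑_{i,j} |i⟩⟨j| ⊗ |i⟩⟨j|`. -/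
def maxEntangled (d : ℕ) : Matrix (Fin d × Fin d) (Fin d × Fin d) ℂ :=
  (d : ℂ)⁻¹ • ∑ i, ∑ j, Matrix.single i j (1 : ℂ) ⊗ₖ Matrix.single i j (1 : ℂ)

/-- The Bell-basis measurement `M_b = (1 ⊗ U_b) φ₊ (1 ⊗ U_b)†` on `BB'`, with `b` running over
the `d²` generalised Pauli operators `U_b`. -/
def bellMeas (d : ℕ) (b : Fin d × Fin d) : Matrix (Fin d × Fin d) (Fin d × Fin d) ℂ :=
  ((1 : Matrix (Fin d) (Fin d) ℂ) ⊗ₖ genPauli d b) * maxEntangled d *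
    ((1 : Matrix (Fin d) (Fin d) ℂ) ⊗ₖ genPauli d b)ᴴ

end Buscemi

end

open scoped Kronecker ComplexOrder Matrix

namespace Buscemi

/-! ### Partial traces: duality, cyclicity and positivity. -/

section PartialTrace

/-! The two robustnesses are compared through their sets of admissible weights. If a weight `r`
works for the assemblage, Bob applies his measurement to both sides of the decomposition: the noise
assemblage becomes a behaviour, and each hidden state `σ_λ` becomes a measurement on `B'`. So the
teleportation weights lie in the Buscemi weights for every choice of Bob's measurement
(`teleportationWeights_subset_buscemiWeights`), which gives `R_BN ≤ R_T`.

For the Bell measurement with tomographically complete inputs the inclusion reverses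
(`buscemiWeights_subset_teleportationWeights`). Completeness removes the `ζ_y`, leaving for each
outcome `b` an operator identity on `B'`. To it one applies the linear map `merge`, which undoes
`U_b`, transposes, sums over `b` and divides by `d`. On the Bell term this is the teleportation
protocol and returns `τ` (`teleport_eq_self`). On the noise term it is a channel acting on Bob's
share, so the result is again an assemblage (`isState_amplify_teleport`, `assemblage_amplify`). On a
hidden measurement of Bob it yields a state (`isState_merge`).

Nonemptiness comes from mixing `ρ` into the maximally mixed state, which is a product; the first
inclusion carries it over to the Buscemi weights. -/

theorem posSemidef_trRight {m n : Type*} [Fintype n] {M : Matrix (m × n) (m × n) ℂ} (hM : M.PosSemidef) :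
    (trRight M).PosSemidef := by
  have : trRight M = ∑ k, M.submatrix (fun i => (i, k)) (fun i => (i, k)) := by
    ext i j
    simp [trRight, Matrix.sum_apply]
  rw [this]
  exact Matrix.posSemidef_sum _ fun k _ => hM.submatrix _

variable {m n : Type*} [Fintype m]

theorem trLeft_add (M N : Matrix (m × n) (m × n) ℂ) : trLeft (M + N) = trLeft M + trLeft N := by
  ext i j
  simp [trLeft, Finset.sum_add_distrib]

theorem trLeft_smul (c : ℂ) (M : Matrix (m × n) (m × n) ℂ) : trLeft (c • M) = c • trLeft M := by
  ext i j
  simp [trLeft, Finset.mul_sum]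

theorem trLeft_sum {ι : Type*} (s : Finset ι) (M : ι → Matrix (m × n) (m × n) ℂ) :
    trLeft (∑ b ∈ s, M b) = ∑ b ∈ s, trLeft (M b) := by
  ext i j
  simp only [trLeft, Matrix.sum_apply, Matrix.of_apply]
  exact Finset.sum_comm

theorem trLeft_kronecker (X : Matrix m m ℂ) (Y : Matrix n n ℂ) :
    trLeft (X ⊗ₖ Y) = X.trace • Y := by
  ext i j
  simp [trLeft, Matrix.trace, Finset.sum_mul]

theorem posSemidef_trLeft {M : Matrix (m × n) (m × n) ℂ} (hM : M.PosSemidef) :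
    (trLeft M).PosSemidef := by
  have : trLeft M = ∑ k, M.submatrix (fun i => (k, i)) (fun i => (k, i)) := by
    ext i j
    simp [trLeft, Matrix.sum_apply]
  rw [this]
  exact Matrix.posSemidef_sum _ fun k _ => hM.submatrix _

variable [Fintype n]

theorem trace_trLeft_mul [DecidableEq m] (M : Matrix (m × n) (m × n) ℂ) (Y : Matrix n n ℂ) :
    (trLeft M * Y).trace = (M * ((1 : Matrix m m ℂ) ⊗ₖ Y)).trace := by
  simp only [trLeft, Matrix.trace, Matrix.diag_apply, Matrix.mul_apply, Matrix.of_apply,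
    Fintype.sum_prod_type, Matrix.kroneckerMap_apply, Matrix.one_apply, ite_mul, one_mul, zero_mul,
    mul_ite, mul_zero, Finset.sum_mul, Finset.sum_ite_irrel, Finset.sum_const_zero,
    Finset.sum_ite_eq', Finset.mem_univ, if_true]
  symm
  rw [Finset.sum_comm]
  exact Finset.sum_congr rfl fun _ _ => Finset.sum_comm

theorem trace_trRight_mul [DecidableEq n] (M : Matrix (m × n) (m × n) ℂ) (X : Matrix m m ℂ) :
    (trRight M * X).trace = (M * (X ⊗ₖ (1 : Matrix n n ℂ))).trace := by
  simp only [trRight, Matrix.trace, Matrix.diag_apply, Matrix.mul_apply, Matrix.of_apply,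
    Fintype.sum_prod_type, Matrix.kroneckerMap_apply, Matrix.one_apply, mul_ite, mul_one, mul_zero,
    Finset.sum_mul, Finset.sum_ite_eq', Finset.mem_univ, if_true]
  exact Finset.sum_congr rfl fun k _ => Finset.sum_comm

theorem trace_trLeft (M : Matrix (m × n) (m × n) ℂ) : (trLeft M).trace = M.trace := by
  simp only [trLeft, Matrix.trace, Matrix.diag_apply, Matrix.of_apply, Fintype.sum_prod_type]
  exact Finset.sum_comm

/-- A partial trace is cyclic with respect to operators on the factor traced out. -/
theorem trLeft_mul_kronecker_one_comm [DecidableEq n] (M : Matrix (m × n) (m × n) ℂ)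
    (C : Matrix m m ℂ) :
    trLeft (M * (C ⊗ₖ (1 : Matrix n n ℂ))) = trLeft ((C ⊗ₖ (1 : Matrix n n ℂ)) * M) := by
  ext i j
  simp only [trLeft, Matrix.of_apply, Matrix.mul_apply, Fintype.sum_prod_type,
    Matrix.kroneckerMap_apply, Matrix.one_apply, mul_ite, mul_one, mul_zero, ite_mul, zero_mul,
    Finset.sum_ite_eq, Finset.sum_ite_eq', Finset.mem_univ, if_true]
  rw [Finset.sum_comm]
  exact Finset.sum_congr rfl fun _ _ => Finset.sum_congr rfl fun _ _ => mul_comm _ _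

theorem trLeft_mul_kronecker_one_apply [DecidableEq n] (M : Matrix (m × n) (m × n) ℂ)
    (X : Matrix m m ℂ) (i j : n) :
    trLeft (M * (X ⊗ₖ (1 : Matrix n n ℂ))) i j = ∑ k, ∑ l, M (k, i) (l, j) * X l k := by
  simp [trLeft, Matrix.mul_apply, Fintype.sum_prod_type, Matrix.one_apply]

theorem exists_eq_conjTranspose_mul_self {X : Matrix m m ℂ} (hX : X.PosSemidef) :
    ∃ C : Matrix m m ℂ, X = Cᴴ * C := by
  classical
  open scoped MatrixOrder in
  obtain ⟨C, hC⟩ := CStarAlgebra.nonneg_iff_eq_star_mul_self.mp hX.nonneg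
  exact ⟨C, hC⟩

theorem posSemidef_trLeft_mul_kronecker_one [DecidableEq n] {M : Matrix (m × n) (m × n) ℂ}
    {X : Matrix m m ℂ} (hM : M.PosSemidef) (hX : X.PosSemidef) :
    (trLeft (M * (X ⊗ₖ (1 : Matrix n n ℂ)))).PosSemidef := by
  obtain ⟨C, rfl⟩ := exists_eq_conjTranspose_mul_self hX
  have h : (Cᴴ * C) ⊗ₖ (1 : Matrix n n ℂ) =
      (Cᴴ ⊗ₖ (1 : Matrix n n ℂ)) * (C ⊗ₖ (1 : Matrix n n ℂ)) := by
    rw [← Matrix.mul_kronecker_mul, one_mul]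
  -- Cycling one factor `C` to the front turns the product into a congruence of `M`.
  rw [h, ← Matrix.mul_assoc, trLeft_mul_kronecker_one_comm]
  have h2 := hM.mul_mul_conjTranspose_same (C ⊗ₖ (1 : Matrix n n ℂ))
  rw [Matrix.conjTranspose_kronecker, Matrix.conjTranspose_one, Matrix.mul_assoc] at h2
  exact posSemidef_trLeft h2

end PartialTrace

/-! ### Behaviours as pairings of an assemblage with Bob's measurement. -/

section Reformulation

variable {V A B W O P X Y : Type*} [Fintype V] [Fintype A] [DecidableEq A] [Fintype B]
  [DecidableEq B] [Fintype W]

/-- A change of viewpoint: instead of `ζ_y` inducing a measurement on `B`, the operator `S` on `B`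
induces one on `B'`, so that the input `ζ y` appears as a bare factor. -/
theorem trace_mul_bobMeas [DecidableEq W] (N : P → Matrix (B × W) (B × W) ℂ) (ζ : Y → Matrix W W ℂ)
    (b : P) (y : Y) (S : Matrix B B ℂ) :
    (S * bobMeas N ζ b y).trace = (trLeft (N b * (S ⊗ₖ (1 : Matrix W W ℂ))) * ζ y).trace := by
  rw [Matrix.trace_mul_comm, bobMeas, trace_trRight_mul, trace_trLeft_mul, Matrix.mul_assoc,
    Matrix.mul_assoc, ← Matrix.mul_kronecker_mul, ← Matrix.mul_kronecker_mul]
  simp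

theorem behaviour_eq_trace (M : O → Matrix (V × A) (V × A) ℂ) (ω : X → Matrix V V ℂ)
    (N : P → Matrix (B × W) (B × W) ℂ) (ζ : Y → Matrix W W ℂ)
    (ρ : Matrix (A × B) (A × B) ℂ) (a : O) (b : P) (x : X) (y : Y) :
    behaviour M ω N ζ ρ a b x y = (assemblage M ω ρ a x * bobMeas N ζ b y).trace := by
  rw [behaviour, assemblage, trace_trLeft_mul, Matrix.trace_mul_comm (_ * ρ), ← Matrix.mul_assoc,
    ← Matrix.mul_kronecker_mul, one_mul, mul_one]

theorem behaviour_eq_trace_trLeft [DecidableEq W] (M : O → Matrix (V × A) (V × A) ℂ)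
    (ω : X → Matrix V V ℂ) (N : P → Matrix (B × W) (B × W) ℂ) (ζ : Y → Matrix W W ℂ)
    (ρ : Matrix (A × B) (A × B) ℂ) (a : O) (b : P) (x : X) (y : Y) :
    behaviour M ω N ζ ρ a b x y =
      (trLeft (N b * (assemblage M ω ρ a x ⊗ₖ (1 : Matrix W W ℂ))) * ζ y).trace := by
  rw [behaviour_eq_trace, trace_mul_bobMeas]

end Reformulation

/-! ### Measuring an assemblage cannot increase the robustness. -/

section Upper

variable {V W O P X Y : Type*} [Fintype V] [DecidableEq V] [Fintype W] [DecidableEq W] [Fintype O]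
  [Fintype P]

theorem isPOVM_trLeft_of_isState {B : Type*} [Fintype B] [DecidableEq B]
    {N : P → Matrix (B × W) (B × W) ℂ} (hN : IsPOVM N) {s : Matrix B B ℂ} (hs : IsState s) :
    IsPOVM fun b => trLeft (N b * (s ⊗ₖ (1 : Matrix W W ℂ))) := by
  refine ⟨fun b => posSemidef_trLeft_mul_kronecker_one (hN.1 b) hs.1, ?_⟩
  rw [← trLeft_sum, ← Finset.sum_mul, hN.2, one_mul, trLeft_kronecker, hs.2, one_smul]

theorem teleportationWeights_subset_buscemiWeights {A : Type*} [Fintype A] [DecidableEq A] {e : ℕ}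
    (ω : X → Matrix V V ℂ) (M : O → Matrix (V × A) (V × A) ℂ)
    (ρ : Matrix (A × Fin e) (A × Fin e) ℂ) (ζ : Y → Matrix W W ℂ)
    {N : P → Matrix (Fin e × W) (Fin e × W) ℂ} (hN : IsPOVM N) :
    teleportationWeights ω (assemblage M ω ρ) ⊆ buscemiWeights ω ζ (behaviour M ω N ζ ρ) := by
  rintro r ⟨hr, σ, L, ⟨d, M', η, hM', hη, rfl⟩, ⟨n, q, H, s, hq, hH, hs, hL⟩, h⟩
  refine ⟨hr, behaviour M' ω N ζ η, fun a b x y => (L a x * bobMeas N ζ b y).trace,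
    ⟨d, e, M', N, η, hM', hN, hη, rfl⟩,
    ⟨n, q, H, fun l b => trLeft (N b * (s l ⊗ₖ (1 : Matrix W W ℂ))), hq, hH,
      fun l => isPOVM_trLeft_of_isState hN (hs l), fun a b x y => ?_⟩, fun a b x y => ?_⟩
  · simp only [hL, Finset.sum_mul, Matrix.trace_sum, Matrix.smul_mul, Matrix.trace_smul,
      trace_mul_bobMeas, smul_eq_mul]
  · have := congrArg (fun S => (S * bobMeas N ζ b y).trace) (h a x)
    simpa only [behaviour_eq_trace, add_mul, Matrix.smul_mul, Matrix.trace_add, Matrix.trace_smul,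
      smul_eq_mul] using this

end Upper

/-! ### Finiteness of the robustness through maximally mixed noise. -/

section Noise

theorem posSemidef_one_sub_of_isState {m : Type*} [Fintype m] [DecidableEq m] {ρ : Matrix m m ℂ}
    (hρ : IsState ρ) : (1 - ρ).PosSemidef := by
  have hH := hρ.1.isHermitian
  -- The eigenvalues are nonnegative and sum to the trace, which is one.
  have hle : ∀ i, hH.eigenvalues i ≤ 1 := by
    intro i
    have hsum : ∑ i, hH.eigenvalues i = 1 := by
      have := hH.trace_eq_sum_eigenvalues
      rw [hρ.2] at this
      exact Complex.ofReal_injective (by simpa using this.symm)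
    rw [← hsum]
    exact Finset.single_le_sum (fun j _ => hρ.1.eigenvalues_nonneg j) (Finset.mem_univ i)
  set U : Matrix m m ℂ := (hH.eigenvectorUnitary : Matrix m m ℂ)
  have hU : U * Uᴴ = 1 := Matrix.mem_unitaryGroup_iff.mp hH.eigenvectorUnitary.2
  have hspec : ρ = U * Matrix.diagonal (fun i => (hH.eigenvalues i : ℂ)) * Uᴴ := by
    conv_lhs => rw [hH.spectral_theorem]
    rfl
  have : 1 - ρ = U * Matrix.diagonal (fun i => (1 - hH.eigenvalues i : ℂ)) * Uᴴ := by
    have hd : Matrix.diagonal (fun i => (1 - hH.eigenvalues i : ℂ)) =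
        1 - Matrix.diagonal (fun i => (hH.eigenvalues i : ℂ)) := by
      rw [← Matrix.diagonal_one, Matrix.diagonal_sub]
    rw [hd, mul_sub, sub_mul, mul_one, hU, ← hspec]
  rw [this]
  refine Matrix.PosSemidef.mul_mul_conjTranspose_same (Matrix.PosSemidef.diagonal fun i => ?_) U
  have := hle i
  simp only [Pi.zero_apply]
  exact_mod_cast sub_nonneg.mpr this

theorem assemblage_add {V A B O X : Type*} [Fintype V] [Fintype A] [DecidableEq A] [Fintype B]
    [DecidableEq B] (M : O → Matrix (V × A) (V × A) ℂ) (ω : X → Matrix V V ℂ)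
    (ρ η : Matrix (A × B) (A × B) ℂ) (a : O) (x : X) :
    assemblage M ω (ρ + η) a x = assemblage M ω ρ a x + assemblage M ω η a x := by
  simp only [assemblage, mul_add, trLeft_add]

theorem assemblage_smul {V A B O X : Type*} [Fintype V] [Fintype A] [DecidableEq A] [Fintype B]
    [DecidableEq B] (M : O → Matrix (V × A) (V × A) ℂ) (ω : X → Matrix V V ℂ)
    (c : ℂ) (ρ : Matrix (A × B) (A × B) ℂ) (a : O) (x : X) :
    assemblage M ω (c • ρ) a x = c • assemblage M ω ρ a x := by
  simp only [assemblage, Matrix.mul_smul, trLeft_smul]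

theorem isState_maximallyMixed {m : Type*} [Fintype m] [DecidableEq m] (hm : Fintype.card m ≠ 0) :
    IsState ((Fintype.card m : ℂ)⁻¹ • (1 : Matrix m m ℂ)) := by
  refine ⟨Matrix.PosSemidef.one.smul ?_, ?_⟩
  · positivity
  · rw [Matrix.trace_smul, Matrix.trace_one, smul_eq_mul, inv_mul_cancel₀ (by exact_mod_cast hm)]

theorem card_ne_zero_of_isState {m : Type*} [Fintype m] {ρ : Matrix m m ℂ} (hρ : IsState ρ) :
    Fintype.card m ≠ 0 := by
  intro h
  have := Fintype.card_eq_zero_iff.mp h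
  have h1 := hρ.2
  simp [Matrix.trace] at h1

theorem isPOVM_trRight {V A O : Type*} [Fintype V] [DecidableEq V] [Fintype A] [DecidableEq A]
    [Fintype O] {M : O → Matrix (V × A) (V × A) ℂ} (hM : IsPOVM M) (hA : Fintype.card A ≠ 0) :
    IsPOVM fun a => (Fintype.card A : ℂ)⁻¹ • trRight (M a) := by
  refine ⟨fun a => (posSemidef_trRight (hM.1 a)).smul (by positivity), ?_⟩
  rw [← Finset.smul_sum]
  have : ∑ a, trRight (M a) = (Fintype.card A : ℂ) • (1 : Matrix V V ℂ) := by
    ext i j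
    have h := fun k => congrFun (congrFun hM.2 (i, k)) (j, k)
    simp only [Matrix.sum_apply, trRight, Matrix.of_apply, Matrix.smul_apply] at h ⊢
    rw [Finset.sum_comm]
    simp [h, Matrix.one_apply, Prod.ext_iff]
  rw [this, smul_smul, inv_mul_cancel₀ (by exact_mod_cast hA), one_smul]

/-- The maximally mixed state is a product, so a single hidden value suffices: Alice's measurement
is averaged over her half and Bob holds his half. -/
theorem isClassicalAssemblage_maximallyMixed {V A B O X : Type*} [Fintype V] [DecidableEq V]
    [Fintype A] [DecidableEq A] [Fintype B] [DecidableEq B] [Fintype O]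
    (ω : X → Matrix V V ℂ) {M : O → Matrix (V × A) (V × A) ℂ} (hM : IsPOVM M)
    (hA : Fintype.card A ≠ 0) (hB : Fintype.card B ≠ 0) :
    IsClassicalAssemblage ω
      (assemblage M ω ((Fintype.card (A × B) : ℂ)⁻¹ • (1 : Matrix (A × B) (A × B) ℂ))) := by
  refine ⟨1, fun _ => 1, fun _ a => (Fintype.card A : ℂ)⁻¹ • trRight (M a),
    fun _ => (Fintype.card B : ℂ)⁻¹ • (1 : Matrix B B ℂ), ?_, fun _ => isPOVM_trRight hM hA,
    fun _ => isState_maximallyMixed hB, fun a x => ?_⟩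
  · simp [stdSimplex]
  · rw [assemblage_smul, assemblage, mul_one, trLeft_kronecker, aliceMeas, trace_trLeft,
      Finset.univ_unique, Finset.sum_singleton, Matrix.smul_mul, Matrix.trace_smul,
      trace_trRight_mul, smul_smul, smul_smul, Fintype.card_prod]
    congr 1
    push_cast
    rw [mul_inv, smul_eq_mul]
    ring

theorem teleportationWeights_nonempty {V B O X : Type*} [Fintype V] [DecidableEq V] [Fintype B]
    [DecidableEq B] [Fintype O] {d : ℕ} (ω : X → Matrix V V ℂ)
    {M : O → Matrix (V × Fin d) (V × Fin d) ℂ} (hM : IsPOVM M)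
    {ρ : Matrix (Fin d × B) (Fin d × B) ℂ} (hρ : IsState ρ) :
    (teleportationWeights ω (assemblage M ω ρ)).Nonempty := by
  have hD := card_ne_zero_of_isState hρ
  have hAB := hD
  rw [Fintype.card_prod] at hAB
  obtain ⟨hA, hB⟩ := mul_ne_zero_iff.mp hAB
  set D : ℂ := (Fintype.card (Fin d × B) : ℂ) with hDdef
  have hD0 : D ≠ 0 := Nat.cast_ne_zero.mpr hD
  have hDinv : 0 ≤ D⁻¹ := by positivity
  set μ : Matrix (Fin d × B) (Fin d × B) ℂ := D⁻¹ • 1 with hμ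
  have hμs : IsState μ := isState_maximallyMixed hD
  -- With `D = dim AB`, the weight is `D` and the noise state is `D⁻¹((1 - ρ) + μ)`, since `ρ + (1 -
  -- ρ) + μ = (1 + D) μ`. Adding `μ` brings the trace of `1 - ρ` from `D - 1` up to `D`, so the case
  -- `D = 1` needs no separate treatment.
  refine ⟨(Fintype.card (Fin d × B) : ℝ), by positivity,
    assemblage M ω (D⁻¹ • ((1 - ρ) + μ)), assemblage M ω μ,
    ⟨d, M, _, hM, ⟨?_, ?_⟩, rfl⟩, isClassicalAssemblage_maximallyMixed ω hM hA hB, fun a x => ?_⟩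
  · exact ((posSemidef_one_sub_of_isState hρ).add hμs.1).smul hDinv
  · rw [Matrix.trace_smul, Matrix.trace_add, Matrix.trace_sub, hμs.2, hρ.2, Matrix.trace_one,
      sub_add_cancel, smul_eq_mul, inv_mul_cancel₀ hD0]
  · rw [← assemblage_smul, ← assemblage_add, ← assemblage_smul]
    congr 1
    push_cast
    rw [← hDdef, smul_smul, mul_inv_cancel₀ hD0, one_smul, hμ, add_smul, smul_smul D,
      mul_inv_cancel₀ hD0, one_smul, one_smul]
    abel

end Noise

/-! ### Channels acting on Bob's share of a state. -/

section Amplification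

variable {A B C : Type*} [Fintype A] [Fintype B] [Fintype C]

/-- The map `id ⊗ E` on operators on a tensor product. -/
def amplify (E : Matrix B B ℂ →ₗ[ℂ] Matrix C C ℂ) (η : Matrix (A × B) (A × B) ℂ) :
    Matrix (A × C) (A × C) ℂ :=
  Matrix.of fun p q => E (Matrix.of fun k l => η (p.1, k) (q.1, l)) p.2 q.2

theorem posSemidef_amplify {κ : Type*} [Fintype κ] {E : Matrix B B ℂ →ₗ[ℂ] Matrix C C ℂ}
    (K : κ → Matrix C B ℂ) (hE : ∀ S, E S = ∑ k, K k * S * (K k)ᴴ)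
    {η : Matrix (A × B) (A × B) ℂ} (hη : η.PosSemidef) : (amplify E η).PosSemidef := by
  classical
  have : amplify E η =
      ∑ k, ((1 : Matrix A A ℂ) ⊗ₖ K k) * η * ((1 : Matrix A A ℂ) ⊗ₖ K k)ᴴ := by
    ext ⟨a, i⟩ ⟨b, j⟩
    simp [amplify, hE, Matrix.sum_apply, Matrix.mul_apply, Fintype.sum_prod_type,
      Matrix.one_apply, Matrix.conjTranspose_apply, apply_ite, ite_mul]
  rw [this]
  exact Matrix.posSemidef_sum _ fun k _ => hη.mul_mul_conjTranspose_same _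

theorem trace_amplify {E : Matrix B B ℂ →ₗ[ℂ] Matrix C C ℂ} (hE : ∀ S, (E S).trace = S.trace)
    (η : Matrix (A × B) (A × B) ℂ) : (amplify E η).trace = η.trace := by
  have h : (amplify E η).trace = ∑ a, (E (Matrix.of fun k l => η (a, k) (a, l))).trace := by
    simp [amplify, Matrix.trace, Fintype.sum_prod_type]
  simp only [h, hE]
  simp [Matrix.trace, Fintype.sum_prod_type]

theorem trLeft_kronecker_one_mul [DecidableEq B] (Q : Matrix A A ℂ)
    (η : Matrix (A × B) (A × B) ℂ) :
    trLeft ((Q ⊗ₖ (1 : Matrix B B ℂ)) * η) =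
      ∑ a, ∑ b, Q a b • (Matrix.of fun k l => η (b, k) (a, l)) := by
  ext i j
  simp [trLeft, Matrix.mul_apply, Fintype.sum_prod_type, Matrix.one_apply, Matrix.sum_apply]

/-- Alice's measurement and Bob's channel act on different factors, so processing the assemblage
amounts to processing the shared state. -/
theorem assemblage_amplify {V O X : Type*} [Fintype V] [DecidableEq A] [DecidableEq B]
    [DecidableEq C] (E : Matrix B B ℂ →ₗ[ℂ] Matrix C C ℂ) (M : O → Matrix (V × A) (V × A) ℂ)
    (ω : X → Matrix V V ℂ) (η : Matrix (A × B) (A × B) ℂ) (a : O) (x : X) :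
    assemblage M ω (amplify E η) a x = E (assemblage M ω η a x) := by
  rw [assemblage, assemblage, trLeft_kronecker_one_mul, trLeft_kronecker_one_mul]
  simp only [map_sum, map_smul]
  rfl

end Amplification

/-! ### The teleportation channel and the reverse inclusion. -/

section Teleport

variable {B P : Type*} [Fintype B] [Fintype P] {d : ℕ}

/-- The operation `S ↦ d⁻¹ ∑_b (U_b† S_b U_b)ᵀ` merging a family of operators indexed by the
outcomes `b`. -/
noncomputable def merge (U : P → Matrix (Fin d) (Fin d) ℂ) :
    (P → Matrix (Fin d) (Fin d) ℂ) →ₗ[ℂ] Matrix (Fin d) (Fin d) ℂ where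
  toFun S := (d : ℂ)⁻¹ • ∑ b, ((U b)ᴴ * S b * U b)ᵀ
  map_add' S T := by
    simp [mul_add, add_mul, Finset.sum_add_distrib, -Matrix.transpose_mul]
  map_smul' c S := by
    simp [smul_comm c, Finset.smul_sum, -Matrix.transpose_mul]

theorem trace_merge {U : P → Matrix (Fin d) (Fin d) ℂ} (hU : ∀ b, U b * (U b)ᴴ = 1)
    (S : P → Matrix (Fin d) (Fin d) ℂ) : (merge U S).trace = (d : ℂ)⁻¹ * (∑ b, S b).trace := by
  simp only [merge, LinearMap.coe_mk, AddHom.coe_mk, Matrix.trace_smul, Matrix.trace_sum,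
    Matrix.trace_transpose, smul_eq_mul]
  congr 1
  refine Finset.sum_congr rfl fun b _ => ?_
  rw [Matrix.trace_mul_comm, ← Matrix.mul_assoc, hU, one_mul]

theorem isState_merge {U : P → Matrix (Fin d) (Fin d) ℂ} (hU : ∀ b, U b * (U b)ᴴ = 1)
    (hd : d ≠ 0) {K : P → Matrix (Fin d) (Fin d) ℂ} (hK : IsPOVM K) : IsState (merge U K) := by
  refine ⟨?_, ?_⟩
  · refine Matrix.PosSemidef.smul (Matrix.posSemidef_sum _ fun b _ => ?_) (by positivity)
    exact ((hK.1 b).conjTranspose_mul_mul_same (U b)).transpose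
  · rw [trace_merge hU, hK.2, Matrix.trace_one, Fintype.card_fin,
      inv_mul_cancel₀ (by exact_mod_cast hd)]

/-- The channel that measures `N`, keeps `B'` and applies the correction for the outcome. -/
noncomputable def teleport (U : P → Matrix (Fin d) (Fin d) ℂ)
    (N : P → Matrix (B × Fin d) (B × Fin d) ℂ) :
    Matrix B B ℂ →ₗ[ℂ] Matrix (Fin d) (Fin d) ℂ :=
  merge U ∘ₗ
    { toFun := fun S b => trLeft (N b * (S ⊗ₖ (1 : Matrix (Fin d) (Fin d) ℂ)))
      map_add' := fun S T => by
        funext b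
        simp [Matrix.add_kronecker, mul_add, trLeft_add]
      map_smul' := fun c S => by
        funext b
        simp [Matrix.smul_kronecker, trLeft_smul] }

theorem teleport_apply (U : P → Matrix (Fin d) (Fin d) ℂ)
    (N : P → Matrix (B × Fin d) (B × Fin d) ℂ) (S : Matrix B B ℂ) :
    teleport U N S =
      merge U fun b => trLeft (N b * (S ⊗ₖ (1 : Matrix (Fin d) (Fin d) ℂ))) := rfl

theorem trace_teleport [DecidableEq B] {U : P → Matrix (Fin d) (Fin d) ℂ}
    (hU : ∀ b, U b * (U b)ᴴ = 1) (hd : d ≠ 0) {N : P → Matrix (B × Fin d) (B × Fin d) ℂ}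
    (hN : IsPOVM N) (S : Matrix B B ℂ) : (teleport U N S).trace = S.trace := by
  rw [teleport_apply, trace_merge hU, ← trLeft_sum, ← Finset.sum_mul, hN.2, one_mul,
    trLeft_kronecker, Matrix.trace_smul, Matrix.trace_one, Fintype.card_fin, smul_eq_mul,
    mul_comm, mul_assoc, mul_inv_cancel₀ (by exact_mod_cast hd), mul_one]

/-- The transpose is what makes this map completely positive. Writing `N = Cᴴ * C`, each row of `C`,
reshaped into a matrix from `B` to `W`, is a Kraus operator. -/
theorem exists_kraus_transpose_trLeft {W : Type*} [Fintype W] [DecidableEq W]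
    {N : Matrix (B × W) (B × W) ℂ} (hN : N.PosSemidef) :
    ∃ K : B × W → Matrix W B ℂ, ∀ S : Matrix B B ℂ,
      (trLeft (N * (S ⊗ₖ (1 : Matrix W W ℂ))))ᵀ = ∑ c, K c * S * (K c)ᴴ := by
  obtain ⟨C, rfl⟩ := exists_eq_conjTranspose_mul_self hN
  refine ⟨fun c => Matrix.of fun j l => C c (l, j), fun S => ?_⟩
  ext j i
  rw [Matrix.transpose_apply, trLeft_mul_kronecker_one_apply]
  simp only [Matrix.sum_apply, Matrix.mul_apply, Matrix.conjTranspose_apply, Matrix.of_apply,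
    Finset.sum_mul]
  rw [Finset.sum_comm' (t' := Finset.univ) (s' := fun _ => Finset.univ) (by simp)]
  simp_rw [Finset.sum_comm (s := (Finset.univ : Finset B)) (t := (Finset.univ : Finset (B × W)))]
  refine Finset.sum_congr rfl fun c _ => ?_
  rw [Finset.sum_comm]
  refine Finset.sum_congr rfl fun k _ => Finset.sum_congr rfl fun l _ => ?_
  ring

theorem exists_kraus_teleport (U : P → Matrix (Fin d) (Fin d) ℂ) [DecidableEq B]
    {N : P → Matrix (B × Fin d) (B × Fin d) ℂ} (hN : ∀ b, (N b).PosSemidef) :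
    ∃ K : P × (B × Fin d) → Matrix (Fin d) B ℂ, ∀ S : Matrix B B ℂ,
      teleport U N S = ∑ c, K c * S * (K c)ᴴ := by
  choose K hK using fun b => exists_kraus_transpose_trLeft (hN b)
  -- The prefactor `d⁻¹` is split evenly between each Kraus operator and its adjoint.
  obtain ⟨s, hs⟩ : ∃ s : ℂ, s = (((Real.sqrt d)⁻¹ : ℝ) : ℂ) := ⟨_, rfl⟩
  have hss : s * star s = (d : ℂ)⁻¹ := by
    rw [hs, Complex.star_def, Complex.conj_ofReal, ← Complex.ofReal_mul, ← mul_inv,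
      Real.mul_self_sqrt (Nat.cast_nonneg d)]
    simp
  refine ⟨fun c => s • ((U c.1)ᵀ * K c.1 c.2), fun S => ?_⟩
  rw [teleport_apply, Fintype.sum_prod_type]
  simp only [merge, LinearMap.coe_mk, AddHom.coe_mk, Finset.smul_sum]
  refine Finset.sum_congr rfl fun b _ => ?_
  rw [Matrix.transpose_mul, Matrix.transpose_mul, hK]
  simp only [Matrix.conjTranspose_smul, Matrix.smul_mul, Matrix.mul_smul, smul_smul, mul_comm, hss,
    Matrix.conjTranspose_mul, Matrix.mul_sum, Matrix.sum_mul, Finset.smul_sum]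
  refine Finset.sum_congr rfl fun c _ => ?_
  simp only [Matrix.mul_assoc]
  rfl

theorem isState_amplify_teleport {A : Type*} [Fintype A] [DecidableEq B]
    {U : P → Matrix (Fin d) (Fin d) ℂ}
    (hU : ∀ b, U b * (U b)ᴴ = 1) (hd : d ≠ 0) {N : P → Matrix (B × Fin d) (B × Fin d) ℂ}
    (hN : IsPOVM N) {η : Matrix (A × B) (A × B) ℂ} (hη : IsState η) :
    IsState (amplify (teleport U N) η) := by
  obtain ⟨K, hK⟩ := exists_kraus_teleport U hN.1
  exact ⟨posSemidef_amplify K hK hη.1, by rw [trace_amplify (trace_teleport hU hd hN), hη.2]⟩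

/-- The hypothesis on `N` says that `N b` is `d⁻¹` times the rank-one operator on the vectorisation
of `U b`. Outcome `b` then leaves `d⁻¹ U_b Sᵀ U_b†` on `B'`; the correction turns it into `d⁻¹ S`,
and the `d²` outcomes together with the prefactor `d⁻¹` of `merge` add up to `S`. -/
theorem teleport_eq_self {U : P → Matrix (Fin d) (Fin d) ℂ} (hU : ∀ b, (U b)ᴴ * U b = 1)
    (hd : d ≠ 0) (hP : Fintype.card P = d ^ 2) {N : P → Matrix (Fin d × Fin d) (Fin d × Fin d) ℂ}
    (hN : ∀ b i j k l, N b (i, k) (j, l) = (d : ℂ)⁻¹ * (U b k i * star (U b l j)))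
    (S : Matrix (Fin d) (Fin d) ℂ) : teleport U N S = S := by
  have hd0 : (d : ℂ) ≠ 0 := by exact_mod_cast hd
  have h : ∀ b, trLeft (N b * (S ⊗ₖ (1 : Matrix (Fin d) (Fin d) ℂ))) =
      (d : ℂ)⁻¹ • (U b * Sᵀ * (U b)ᴴ) := by
    intro b
    ext i j
    rw [trLeft_mul_kronecker_one_apply]
    simp only [hN, Matrix.smul_apply, Matrix.mul_apply, Matrix.conjTranspose_apply,
      Matrix.transpose_apply, Finset.sum_mul, Finset.mul_sum, smul_eq_mul]
    rw [Finset.sum_comm]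
    refine Finset.sum_congr rfl fun k _ => Finset.sum_congr rfl fun l _ => ?_
    ring
  rw [teleport_apply]
  simp only [h, merge, LinearMap.coe_mk, AddHom.coe_mk]
  have h2 : ∀ b, ((U b)ᴴ * ((d : ℂ)⁻¹ • (U b * Sᵀ * (U b)ᴴ)) * U b)ᵀ = (d : ℂ)⁻¹ • S := by
    intro b
    rw [Matrix.mul_smul, Matrix.smul_mul, Matrix.transpose_smul]
    congr 1
    rw [Matrix.mul_assoc, Matrix.mul_assoc, hU, mul_one, ← Matrix.mul_assoc, hU, one_mul,
      Matrix.transpose_transpose]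
  rw [Finset.sum_congr rfl fun b _ => h2 b, Finset.sum_const, Finset.card_univ, hP,
    ← Nat.cast_smul_eq_nsmul ℂ, smul_smul, smul_smul]
  push_cast
  field_simp
  simp

theorem eq_of_forall_trace_mul_eq {W Y : Type*} [Fintype W] {ζ : Y → Matrix W W ℂ}
    (hζ : TomographicallyComplete ζ) {S T : Matrix W W ℂ}
    (h : ∀ y, (S * ζ y).trace = (T * ζ y).trace) : S = T := by
  classical
  rw [Matrix.ext_iff_trace_mul_right]
  intro Z
  have hZ : Z ∈ Submodule.span ℂ (Set.range ζ) := by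
    rw [hζ]
    trivial
  induction hZ using Submodule.span_induction with
  | mem z hz =>
    obtain ⟨y, rfl⟩ := hz
    exact h y
  | zero => simp
  | add z w _ _ hz hw => rw [mul_add, mul_add, Matrix.trace_add, Matrix.trace_add, hz, hw]
  | smul c z _ hz => rw [Matrix.mul_smul, Matrix.mul_smul, Matrix.trace_smul, Matrix.trace_smul, hz]

theorem buscemiWeights_subset_teleportationWeights {V A O X Y : Type*} [Fintype V] [DecidableEq V]
    [Fintype A] [DecidableEq A] [Fintype O] (ω : X → Matrix V V ℂ)
    (M : O → Matrix (V × A) (V × A) ℂ) (ρ : Matrix (A × Fin d) (A × Fin d) ℂ)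
    {ζ : Y → Matrix (Fin d) (Fin d) ℂ} (hζ : TomographicallyComplete ζ)
    {U : P → Matrix (Fin d) (Fin d) ℂ} (hU : ∀ b, (U b)ᴴ * U b = 1)
    (hd : d ≠ 0) (hP : Fintype.card P = d ^ 2) {N : P → Matrix (Fin d × Fin d) (Fin d × Fin d) ℂ}
    (hN : ∀ b i j k l, N b (i, k) (j, l) = (d : ℂ)⁻¹ * (U b k i * star (U b l j))) :
    buscemiWeights ω ζ (behaviour M ω N ζ ρ) ⊆ teleportationWeights ω (assemblage M ω ρ) := by
  have hU' : ∀ b, U b * (U b)ᴴ = 1 := fun b => mul_eq_one_comm.mp (hU b)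
  rintro r ⟨hr, g, L, ⟨dA, dB, M', N', η, hM', hN', hη, rfl⟩, ⟨n, q, H, K, hq, hH, hK, hL⟩, h⟩
  refine ⟨hr, fun a x => teleport U N' (assemblage M' ω η a x),
    fun a x => ∑ l, ((q l : ℂ) * (H l a * ω x).trace) • merge U (K l),
    ⟨dA, M', amplify (teleport U N') η, hM', isState_amplify_teleport hU' hd hN' hη, ?_⟩,
    ⟨n, q, H, fun l => merge U (K l), hq, hH, fun l => isState_merge hU' hd (hK l),
      fun _ _ => rfl⟩, fun a x => ?_⟩
  · funext a x
    rw [assemblage_amplify]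
  · have key : (fun b => trLeft (N b * (assemblage M ω ρ a x ⊗ₖ
            (1 : Matrix (Fin d) (Fin d) ℂ)))) +
          (r : ℂ) • (fun b => trLeft (N' b * (assemblage M' ω η a x ⊗ₖ
            (1 : Matrix (Fin d) (Fin d) ℂ)))) =
        (1 + r : ℂ) • ∑ l, ((q l : ℂ) * (H l a * ω x).trace) • K l := by
      funext b
      refine eq_of_forall_trace_mul_eq hζ fun y => ?_
      have := h a b x y
      rw [hL, behaviour_eq_trace_trLeft, behaviour_eq_trace_trLeft] at this
      simpa [add_mul, Matrix.sum_mul, Matrix.trace_sum, Finset.sum_apply] using this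
    have := congrArg (merge U) key
    rw [map_add, map_smul, map_smul, map_sum, ← teleport_apply, ← teleport_apply,
      teleport_eq_self hU hd hP hN] at this
    simpa only [map_smul] using this

theorem robustnessBN_eq_robustnessT {dA : ℕ} {V O X Y : Type*} [Fintype V] [DecidableEq V]
    [Fintype O] (ω : X → Matrix V V ℂ)
    (M : O → Matrix (V × Fin dA) (V × Fin dA) ℂ) (ρ : Matrix (Fin dA × Fin d) (Fin dA × Fin d) ℂ)
    {ζ : Y → Matrix (Fin d) (Fin d) ℂ} (hζ : TomographicallyComplete ζ)
    {U : P → Matrix (Fin d) (Fin d) ℂ} (hU : ∀ b, (U b)ᴴ * U b = 1)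
    (hd : d ≠ 0) (hP : Fintype.card P = d ^ 2) {N : P → Matrix (Fin d × Fin d) (Fin d × Fin d) ℂ}
    (hN : ∀ b i j k l, N b (i, k) (j, l) = (d : ℂ)⁻¹ * (U b k i * star (U b l j)))
    (hNP : IsPOVM N) :
    robustnessBN ω ζ (behaviour M ω N ζ ρ) = robustnessT ω (assemblage M ω ρ) := by
  rw [robustnessBN, robustnessT, (buscemiWeights_subset_teleportationWeights ω M ρ hζ hU hd hP
    hN).antisymm (teleportationWeights_subset_buscemiWeights ω M ρ ζ hNP)]

end Teleport

/-! ### Generalised Paulis and the Bell measurement. -/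

section Bell

/-- Orthogonality of the characters of the cyclic group of order `d`: off the diagonal the sum is
geometric, with ratio a `d`-th root of unity other than one. -/
theorem sum_exp_mul_div {d : ℕ} (hd : d ≠ 0) (p q : Fin d) :
    ∑ k : Fin d, Complex.exp (2 * Real.pi * Complex.I * (k : ℕ) * (p : ℕ) / d) *
      star (Complex.exp (2 * Real.pi * Complex.I * (k : ℕ) * (q : ℕ) / d)) =
      if p = q then (d : ℂ) else 0 := by
  have hd0 : (d : ℂ) ≠ 0 := by exact_mod_cast hd
  have hterm : ∀ k : Fin d, Complex.exp (2 * Real.pi * Complex.I * (k : ℕ) * (p : ℕ) / d) *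
      star (Complex.exp (2 * Real.pi * Complex.I * (k : ℕ) * (q : ℕ) / d)) =
      Complex.exp (2 * Real.pi * Complex.I * ((p : ℕ) - (q : ℕ)) / d) ^ (k : ℕ) := by
    intro k
    rw [Complex.star_def, ← Complex.exp_conj, ← Complex.exp_add, ← Complex.exp_nat_mul]
    congr 1
    simp only [map_div₀, map_mul, map_ofNat, Complex.conj_ofReal, Complex.conj_I, map_natCast]
    field_simp
    ring
  rw [Finset.sum_congr rfl fun k _ => hterm k,
    Fin.sum_univ_eq_sum_range
      (fun k => Complex.exp (2 * Real.pi * Complex.I * ((p : ℕ) - (q : ℕ)) / d) ^ k)]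
  split_ifs with hpq
  · subst hpq
    simp
  · have hne : Complex.exp (2 * Real.pi * Complex.I * ((p : ℕ) - (q : ℕ)) / d) ≠ 1 := by
      intro h1
      obtain ⟨n, hn⟩ := Complex.exp_eq_one_iff.mp h1
      have h2 : ((p : ℕ) : ℂ) - (q : ℕ) = n * d := by
        have := Complex.two_pi_I_ne_zero
        field_simp at hn
        linear_combination hn
      have h3 : ((p : ℕ) : ℤ) - (q : ℕ) = n * d := by exact_mod_cast h2
      have h4 : ((p : ℕ) : ℤ) - (q : ℕ) = 0 := by
        refine Int.eq_zero_of_abs_lt_dvd ⟨n, by rw [h3, mul_comm]⟩ ?_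
        have := p.2
        have := q.2
        rw [abs_lt]
        omega
      exact hpq (Fin.ext (by omega))
    rw [geom_sum_eq hne, ← Complex.exp_nat_mul]
    have : Complex.exp (d * (2 * Real.pi * Complex.I * ((p : ℕ) - (q : ℕ)) / d)) = 1 := by
      rw [Complex.exp_eq_one_iff]
      refine ⟨(p : ℕ) - (q : ℕ), ?_⟩
      push_cast
      field_simp
    rw [this, sub_self, zero_div]

theorem genPauli_conjTranspose_mul_self {d : ℕ} (hd : d ≠ 0) (b : Fin d × Fin d) :
    (genPauli d b)ᴴ * genPauli d b = 1 := by
  have : NeZero d := ⟨hd⟩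
  ext i j
  simp only [Matrix.mul_apply, Matrix.conjTranspose_apply, genPauli, Matrix.of_apply,
    Matrix.one_apply, mul_ite, mul_zero, Finset.sum_ite_eq', Finset.mem_univ, if_true,
    add_left_inj]
  by_cases h : i = j
  · subst h
    rw [if_pos rfl, if_pos rfl, Complex.star_def, ← Complex.exp_conj, ← Complex.exp_add,
      Complex.exp_eq_one_iff]
    refine ⟨0, ?_⟩
    simp only [map_div₀, map_mul, map_ofNat, Complex.conj_ofReal, Complex.conj_I, map_natCast]
    push_cast
    ring
  · rw [if_neg h, if_neg (Ne.symm h), star_zero, zero_mul]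

theorem bellMeas_apply {d : ℕ} (b : Fin d × Fin d) (i j k l : Fin d) :
    bellMeas d b (i, k) (j, l) =
      (d : ℂ)⁻¹ * (genPauli d b k i * star (genPauli d b l j)) := by
  have h : ∀ p q : Fin d × Fin d, maxEntangled d p q =
      (d : ℂ)⁻¹ * ((if p.1 = p.2 then 1 else 0) * (if q.1 = q.2 then 1 else 0)) := by
    rintro ⟨p, p'⟩ ⟨q, q'⟩
    simp [maxEntangled, Matrix.sum_apply, Matrix.single_apply, ite_and, eq_comm]
    split_ifs <;> rfl
  simp [bellMeas, Matrix.mul_apply, Fintype.sum_prod_type, h, Matrix.one_apply,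
    Matrix.conjTranspose_apply, ite_mul, apply_ite, mul_assoc, mul_left_comm]

theorem isPOVM_bellMeas {d : ℕ} (hd : d ≠ 0) : IsPOVM (bellMeas d) := by
  have : NeZero d := ⟨hd⟩
  have hd0 : (d : ℂ) ≠ 0 := by exact_mod_cast hd
  refine ⟨fun b => ?_, ?_⟩
  · have : bellMeas d b = (d : ℂ)⁻¹ • Matrix.vecMulVec
        (fun p : Fin d × Fin d => genPauli d b p.2 p.1)
        (star fun p : Fin d × Fin d => genPauli d b p.2 p.1) := by
      ext ⟨i, k⟩ ⟨j, l⟩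
      rw [bellMeas_apply]
      rfl
    rw [this]
    exact (Matrix.posSemidef_vecMulVec_self_star _).smul (by positivity)
  · ext ⟨i, k⟩ ⟨j, l⟩
    rw [Matrix.sum_apply, Fintype.sum_prod_type]
    simp only [bellMeas_apply, ← Finset.mul_sum]
    -- The sum over the phases `Z^t` forces `i = j`; afterwards only the shift `s = k - i`
    -- contributes, which forces `k = l`.
    have h : ∀ s : Fin d, ∑ t : Fin d, genPauli d (s, t) k i * star (genPauli d (s, t) l j) =
        if k = i + s then if l = j + s then if i = j then (d : ℂ) else 0 else 0 else 0 := by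
      intro s
      rw [← sum_exp_mul_div hd i j]
      by_cases h1 : k = i + s <;> by_cases h2 : l = j + s <;> simp [genPauli, h1, h2]
    simp only [h]
    have h' : ∀ s : Fin d, (k = i + s ↔ s = k - i) := fun s => by
      rw [eq_sub_iff_add_eq', eq_comm]
    simp only [h', Finset.sum_ite_eq', Finset.mem_univ, if_true]
    by_cases hij : i = j
    · subst hij
      by_cases hkl : k = l
      · subst hkl
        simp [hd0]
      · simp [hkl, Ne.symm hkl]
    · simp [hij]

end Bell

/-! ### Existence of a finite tomographically complete family of states. -/

section Tomography

theorem span_isState_eq_top (d : ℕ) :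
    Submodule.span ℂ {ρ : Matrix (Fin d) (Fin d) ℂ | IsState ρ} = ⊤ := by
  set S := Submodule.span ℂ {ρ : Matrix (Fin d) (Fin d) ℂ | IsState ρ}
  have hpos : ∀ Q : Matrix (Fin d) (Fin d) ℂ, Q.PosSemidef → Q ∈ S := by
    intro Q hQ
    by_cases h : Q.trace = 0
    · rw [hQ.trace_eq_zero_iff.mp h]
      exact S.zero_mem
    · have : Q = Q.trace • (Q.trace⁻¹ • Q) := by
        rw [smul_smul, mul_inv_cancel₀ h, one_smul]
      rw [this]
      refine S.smul_mem _ (Submodule.subset_span ⟨hQ.smul ?_, ?_⟩)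
      · exact inv_nonneg.mpr hQ.trace_nonneg
      · rw [Matrix.trace_smul, smul_eq_mul, inv_mul_cancel₀ h]
  have hvec : ∀ v : Fin d → ℂ, Matrix.vecMulVec v (star v) ∈ S := fun v =>
    hpos _ (Matrix.posSemidef_vecMulVec_self_star v)
  have hpol : ∀ u v : Fin d → ℂ, Matrix.vecMulVec u (star v) ∈ S := by
    intro u v
    -- Polarisation: off-diagonal rank-one operators are combinations of positive ones.
    have : Matrix.vecMulVec u (star v) = (4 : ℂ)⁻¹ •
        (Matrix.vecMulVec (u + v) (star (u + v)) - Matrix.vecMulVec (u - v) (star (u - v)) +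
          Complex.I • Matrix.vecMulVec (u + Complex.I • v) (star (u + Complex.I • v)) -
          Complex.I • Matrix.vecMulVec (u - Complex.I • v) (star (u - Complex.I • v))) := by
      ext i j
      simp only [Matrix.vecMulVec_apply, Matrix.smul_apply, Matrix.sub_apply, Matrix.add_apply,
        Pi.star_apply, Pi.add_apply, Pi.sub_apply, Pi.smul_apply, star_add, star_sub, star_smul,
        smul_eq_mul, Complex.star_def, Complex.conj_I]
      ring_nf
      simp only [Complex.I_sq]
      ring
    rw [this]
    exact S.smul_mem _ (S.sub_mem (S.add_mem (S.sub_mem (hvec _) (hvec _))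
      (S.smul_mem _ (hvec _))) (S.smul_mem _ (hvec _)))
  rw [eq_top_iff]
  intro Q _
  rw [Matrix.matrix_eq_sum_single Q]
  refine S.sum_mem fun i _ => S.sum_mem fun j _ => ?_
  have : Matrix.single i j (Q i j) =
      Q i j • Matrix.vecMulVec (Pi.single i (1 : ℂ)) (star (Pi.single j (1 : ℂ))) := by
    ext k l
    simp [Matrix.vecMulVec_apply, Matrix.single_apply, Pi.single_apply, eq_comm, ite_and]
    split_ifs <;> simp_all
  rw [this]
  exact S.smul_mem _ (hpol _ _)

theorem exists_tomographicallyComplete_isState (d : ℕ) :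
    ∃ (n : ℕ) (ζ : Fin n → Matrix (Fin d) (Fin d) ℂ),
      (∀ y, IsState (ζ y)) ∧ TomographicallyComplete ζ := by
  obtain ⟨s, hs, hspan⟩ := (Submodule.fg_span_iff_fg_span_finset_subset (R := ℂ)
    {ρ : Matrix (Fin d) (Fin d) ℂ | IsState ρ}).mp 
    (IsNoetherian.noetherian (R := ℂ) _)
  refine ⟨s.card, fun y => (s.equivFin.symm y : Matrix (Fin d) (Fin d) ℂ),
    fun y => hs (s.equivFin.symm y).2, ?_⟩
  have hr : Set.range (fun y => (s.equivFin.symm y : Matrix (Fin d) (Fin d) ℂ)) = s := by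
    ext Q
    constructor
    · rintro ⟨y, rfl⟩
      exact (s.equivFin.symm y).2
    · intro hQ
      exact ⟨s.equivFin ⟨Q, hQ⟩, by simp⟩
  rw [TomographicallyComplete, hr, ← hspan, span_isState_eq_top]

end Tomography

end Buscemi

/-! ### Assembly of the main theorem. -/

theorem mainTheorem2 (dV dA dB oA iA : ℕ)
    (ω : Fin iA → Matrix (Fin dV) (Fin dV) ℂ) (hω : ∀ x, Buscemi.IsState (ω x))
    (M : Fin oA → Matrix (Fin dV × Fin dA) (Fin dV × Fin dA) ℂ) (hM : Buscemi.IsPOVM M)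
    (ρ : Matrix (Fin dA × Fin dB) (Fin dA × Fin dB) ℂ) (hρ : Buscemi.IsState ρ) :
    -- the infima defining the robustnesses are taken over nonempty sets
    (Buscemi.teleportationWeights ω (Buscemi.assemblage M ω ρ)).Nonempty ∧
    (∀ (dW oB iB : ℕ) (ζ : Fin iB → Matrix (Fin dW) (Fin dW) ℂ)
      (N : Fin oB → Matrix (Fin dB × Fin dW) (Fin dB × Fin dW) ℂ),
      (∀ y, Buscemi.IsState (ζ y)) → Buscemi.IsPOVM N →
      (Buscemi.buscemiWeights ω ζ (Buscemi.behaviour M ω N ζ ρ)).Nonempty) ∧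
    -- the maximum over all generalised measurement sets of Bob
    IsGreatest
      {R : ℝ | ∃ (dW oB iB : ℕ) (ζ : Fin iB → Matrix (Fin dW) (Fin dW) ℂ)
        (N : Fin oB → Matrix (Fin dB × Fin dW) (Fin dB × Fin dW) ℂ),
        (∀ y, Buscemi.IsState (ζ y)) ∧ Buscemi.IsPOVM N ∧
        R = Buscemi.robustnessBN ω ζ (Buscemi.behaviour M ω N ζ ρ)}
      (Buscemi.robustnessT ω (Buscemi.assemblage M ω ρ)) ∧
    -- it is attained by the Bell measurement with any tomographically complete inputs
    Buscemi.IsPOVM (Buscemi.bellMeas dB) ∧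
    ∀ (iB : ℕ) (ζ : Fin iB → Matrix (Fin dB) (Fin dB) ℂ),
      (∀ y, Buscemi.IsState (ζ y)) → Buscemi.TomographicallyComplete ζ →
      Buscemi.robustnessBN ω ζ (Buscemi.behaviour M ω (Buscemi.bellMeas dB) ζ ρ) =
        Buscemi.robustnessT ω (Buscemi.assemblage M ω ρ) := by
  have hT := Buscemi.teleportationWeights_nonempty ω hM hρ
  have hdB : dB ≠ 0 := by
    have := Buscemi.card_ne_zero_of_isState hρ
    simp only [Fintype.card_prod, Fintype.card_fin] at this
    exact (mul_ne_zero_iff.mp this).2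
  have hbell := Buscemi.isPOVM_bellMeas hdB
  have hU := Buscemi.genPauli_conjTranspose_mul_self hdB
  refine ⟨hT, fun dW oB iB ζ N _ hN =>
    hT.mono (Buscemi.teleportationWeights_subset_buscemiWeights ω M ρ ζ hN), ⟨?_, ?_⟩, hbell,
    fun iB ζ _ hζ => Buscemi.robustnessBN_eq_robustnessT ω M ρ hζ hU hdB (by simp [sq])
      Buscemi.bellMeas_apply hbell⟩
  · obtain ⟨iB, ζ, hζs, hζ⟩ := Buscemi.exists_tomographicallyComplete_isState dB
    -- The maximum ranges over outcome sets of the form `Fin oB`, so the pairs labelling the Pauli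
    -- operators are renumbered.
    let e : Fin (dB * dB) ≃ Fin dB × Fin dB := finProdFinEquiv.symm
    have hN : Buscemi.IsPOVM fun b => Buscemi.bellMeas dB (e b) :=
      ⟨fun b => hbell.1 (e b), (e.sum_comp (Buscemi.bellMeas dB)).trans hbell.2⟩
    exact ⟨dB, dB * dB, iB, ζ, fun b => Buscemi.bellMeas dB (e b), hζs, hN,
      (Buscemi.robustnessBN_eq_robustnessT ω M ρ hζ (U := fun b => Buscemi.genPauli dB (e b))
        (fun b => hU (e b)) hdB (by simp [sq]) (fun b => Buscemi.bellMeas_apply (e b)) hN).symm⟩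
  · rintro R ⟨dW, oB, iB, ζ, N, _, hN, rfl⟩
    -- The larger weight set has the smaller infimum; zero is a lower bound and `hT` supplies
    -- nonemptiness.
    exact csInf_le_csInf ⟨0, fun r hr => hr.1⟩ hT
      (Buscemi.teleportationWeights_subset_buscemiWeights ω M ρ ζ hN)
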